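/- Let $n\ge 1$. A discrete cubic string consists of masses $m_1,\dots,m_n>0$ at points $x_1<\dots<x_n$; put $l_j=x_{j+1}-x_j$ $(1\le j\le n-1)$. Consider $$-\phi'''(x)=z\,m(x)\,\phi(x)\quad (x\in\mathbf R),\qquad m=2\sum_{k=1}^n m_k\,\delta_{x_k},$$ meaning that $\phi,\phi'$ are continuous, $\phi'''=0$ away from the points $x_k$, and $\phi''$ jumps by $-2z\,m_k\,\phi(x_k)$ at $x_k$, with boundary conditions $\phi'(-\infty)=\phi''(-\infty)=0$, $\phi''(\infty)=0$. The spectral data of the string are: the nonzero eigenvalues $z=\lambda_k$, $0<\lambda_1<\dots<\lambda_{n-1}$; the residues $b_1,\dots,b_{n-1}\in\mathbf R$ of the Weyl function $$W(z)=\frac{\phi'(x_n+;z)}{\phi''(x_n+;z)}=\sum_{k=1}^{n-1}\frac{b_k}{z-\lambda_k},$$ where $\phi(\cdot\,;z)$ is the solution with $\phi(x;z)=1$ for $x<x_1$; and the total mass $M=\sum_{k=1}^n m_k$. Put $$\beta_j=\sum_{p=1}^{n-1} b_p\lambda_p^j,\qquad I_{ij}=\sum_{p,q=1}^{n-1}\frac{\lambda_p^i\lambda_q^j}{\lambda_p+\lambda_q}\,b_pb_q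 ,$$ and let $\mathcal A_k,\mathcal D_k,\mathcal D'_k$ be the following $k\times k$ determinants $(\mathcal A_0=\mathcal D_0=1)$: $\mathcal A_k=\det\bigl(I_{ij}+\tfrac1{2M}\delta_{i0}\delta_{j0}\bigr)_{0\le i,j\le k-1}$; $\mathcal D_k=\det(I_{ij})_{1\le i\le k,\;0\le j\le k-1}$; and $\mathcal D'_k$ has rows $(\beta_{i-1},I_{i0},I_{i1},\dots,I_{i,k-2})$, $1\le i\le k$. Theorem. Let $\{\lambda_k,b_k,M\}$ be the spectral data of a discrete cubic string $\{m_k,x_k\}_{k=1}^n$. Then $$m_{n-k}=\frac{\mathcal D_k^2}{2\,\mathcal A_{k+1}\mathcal A_k}\quad(0\le k\le n-1),\qquad l_{n-k}=-\frac{2\mathcal A_k}{\mathcal D'_k}\quad(1\le k\le n-1).$$ In particular the string is determined uniquely by its spectral data up to translation: a discrete cubic string with $n$ masses has the same spectral data if and only if it has the same masses in the same order and its positions are $x_k+c$ for some $c\in\mathbf R$. -/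

import Mathlib

open Filter Topology

/-- A discrete cubic string with `n = N + 1` point masses: positive masses `m₁, …, mₙ` at positions
`x₁ < ⋯ < xₙ`, i.e. the measure `m = 2 ∑ mₖ δ_{xₖ}`.  Indices start at `0`, so that `mass i` and
`pos i` are `m_{i+1}` and `x_{i+1}`. -/
structure CubicString (N : ℕ) where
  mass : Fin (N + 1) → ℝ
  pos : Fin (N + 1) → ℝ
  mass_pos : ∀ i, 0 < mass i
  pos_strictMono : StrictMono pos

namespace CubicString

variable {N : ℕ}

/-- The distance between neighbouring masses; `gap i` is `l_{i+1} = x_{i+2} - x_{i+1}`. -/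
def gap (s : CubicString N) (i : Fin N) : ℝ := s.pos i.succ - s.pos i.castSucc

/-- `φ` solves `-φ''' = z m φ` on the real line with `m = 2 ∑ mₖ δ_{xₖ}`: `φ` and `φ'` are
continuous, `φ''' = 0` away from the masses, and at `xₖ` the second derivative has one-sided limits
and jumps by `-2 z mₖ φ(xₖ)`. -/
structure IsSolution (s : CubicString N) (z : ℂ) (φ : ℝ → ℂ) : Prop where
  contDiff : ContDiff ℝ 1 φ
  free : ∀ x, x ∉ Set.range s.pos → ContDiffAt ℝ 3 φ x ∧ iteratedDeriv 3 φ x = 0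
  jump : ∀ i, ∃ p q : ℂ,
    Tendsto (iteratedDeriv 2 φ) (𝓝[<] (s.pos i)) (𝓝 p) ∧
    Tendsto (iteratedDeriv 2 φ) (𝓝[>] (s.pos i)) (𝓝 q) ∧
    q - p = -2 * z * (s.mass i : ℂ) * φ (s.pos i)

/-- `z` is an eigenvalue of `-φ''' = z m φ` with the Neumann-like boundary conditions
`φ'(-∞) = φ''(-∞) = 0`, `φ''(∞) = 0`. -/
def IsEigenvalue (s : CubicString N) (z : ℂ) : Prop :=
  ∃ φ : ℝ → ℂ, φ ≠ 0 ∧ s.IsSolution z φ ∧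
    Tendsto (deriv φ) atBot (𝓝 0) ∧
    Tendsto (iteratedDeriv 2 φ) atBot (𝓝 0) ∧
    Tendsto (iteratedDeriv 2 φ) atTop (𝓝 0)

/-- `w = W(z) = φ'(xₙ+) / φ''(xₙ+)`, where `φ = φ(·; z)` is the solution equal to `1` to the left of
all masses, and `φ''(xₙ+) ≠ 0`. (As `φ'` is continuous, `φ'(xₙ+) = φ'(xₙ)`.) -/
def IsWeylValue (s : CubicString N) (z w : ℂ) : Prop :=
  ∃ φ : ℝ → ℂ, s.IsSolution z φ ∧ (∀ x < s.pos 0, φ x = 1) ∧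
    ∃ a : ℂ, a ≠ 0 ∧ Tendsto (iteratedDeriv 2 φ) (𝓝[>] (s.pos (Fin.last N))) (𝓝 a) ∧
      w = deriv φ (s.pos (Fin.last N)) / a

/-- `ev`, `b`, `M` are the spectral data of the string: `ev` lists the nonzero eigenvalues
`0 < λ₁ < ⋯ < λ_{n-1}`, the `bₖ` are the residues in the partial fraction decomposition
`W(z) = ∑ bₖ / (z - λₖ)` of the Weyl function, and `M = ∑ mₖ` is the total mass. -/
structure IsSpectralData (s : CubicString N) (ev b : Fin N → ℝ) (M : ℝ) : Prop where
  ev_pos : ∀ k, 0 < ev k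
  ev_strictMono : StrictMono ev
  isEigenvalue_iff : ∀ z : ℂ, z ≠ 0 → (s.IsEigenvalue z ↔ ∃ k, z = (ev k : ℂ))
  weyl : ∀ z : ℂ, ¬ s.IsEigenvalue z → s.IsWeylValue z (∑ k, (b k : ℂ) / (z - (ev k : ℂ)))
  mass_sum : M = ∑ i, s.mass i

end CubicString

namespace CubicMoments

variable {N : ℕ}

/-- `β_j = ∫ λ^j dμ(λ)` for `μ = ∑ bₖ δ_{λₖ}`. -/
noncomputable def beta (ev b : Fin N → ℝ) (j : ℕ) : ℝ := ∑ p, b p * ev p ^ j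

/-- `I_{ij} = ∬ κ^i λ^j / (κ + λ) dμ(κ) dμ(λ)`. -/
noncomputable def bimoment (ev b : Fin N → ℝ) (i j : ℕ) : ℝ :=
  ∑ p, ∑ q, b p * b q * (ev p ^ i * ev q ^ j / (ev p + ev q))

/-- `𝒜_k`: the determinant of `(I_{ij})_{0 ≤ i, j ≤ k - 1}` with `1 / (2M)` added to `I_{00}`. -/
noncomputable def detA (ev b : Fin N → ℝ) (M : ℝ) (k : ℕ) : ℝ :=
  (Matrix.of fun i j : Fin k =>
    bimoment ev b i j + if (i : ℕ) = 0 ∧ (j : ℕ) = 0 then 1 / (2 * M) else 0).det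

/-- `𝒟_k`: the determinant of `(I_{ij})` with `1 ≤ i ≤ k`, `0 ≤ j ≤ k - 1`. -/
noncomputable def detD (ev b : Fin N → ℝ) (k : ℕ) : ℝ :=
  (Matrix.of fun i j : Fin k => bimoment ev b (i + 1) j).det

/-- `𝒟'_k`: the determinant with rows `(β_{i-1}, I_{i0}, I_{i1}, …, I_{i,k-2})`, `1 ≤ i ≤ k`. -/
noncomputable def detD' (ev b : Fin N → ℝ) (k : ℕ) : ℝ :=
  (Matrix.of fun i j : Fin k =>
    if (j : ℕ) = 0 then beta ev b i else bimoment ev b (i + 1) (j - 1)).det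

end CubicMoments

/-! Between masses `φ` is quadratic, so the state `(φ, φ', φ'')` after each mass is a polynomial in
`z`, obtained by iterating `step`. Besides `phi` one uses the solutions `psi a` that start from `(0,
0, 1)` at mass `a`. Two facts govern everything: solutions at `z` and `-z` have a constant pairing
(`pairing_step`), and the minors of two solutions at `z` form a solution at `-z` (`wedge_step`).

At the last mass, `φ''` vanishes exactly at `0` and the eigenvalues, its derivative at `0` is `-2M`,
and the residues of `φ'/φ''` are the `b q`. Combining the two facts at `±ev q` expresses the
residues of `φ_a/φ''` as a Cauchy-type sum of the values of `ψ''` (`phi_div_derivative`). Summing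
all residues of `z^j φ_a/φ''` then shows that the polynomials `ψ''` of degree `k`, for `a = N - k`,
are biorthogonal to `1, …, X^(k-1)` for the form with kernel `1/(κ+λ)`, the residue at `0` giving
the `1/(2M)` correction (`biformA_psi`).

Since these polynomials equal `1` at `0`, their consecutive differences divided by `X` are adapted
to the shifted form, and their moments are the gaps (`moment_orthoDiff`). In these bases the three
determinants become triangular up to one row expansion, so they are products of leading coefficients
and norms; their quotients isolate each mass and gap. Hence the data fix the masses and gaps, and
the positions up to translation. -/

namespace CubicOrbit

open Polynomial

/-! ### Transfer across gaps and masses, and its invariants. -/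

section Ring

variable {R : Type*} [CommRing R] [Algebra ℝ R]

/-- Transfer of the state `(φ, φ', φ'')` across a gap `l` followed by a mass `m`. -/
noncomputable def step (l m : ℝ) (z : R) (u : R × R × R) : R × R × R :=
  (u.1 + l • u.2.1 + (l ^ 2 / 2) • u.2.2, u.2.1 + l • u.2.2,
    u.2.2 - (2 * m) • (z * (u.1 + l • u.2.1 + (l ^ 2 / 2) • u.2.2)))

/-- The states obtained from the state `v` just after the mass with index `a`. -/
noncomputable def orbit (l m : ℕ → ℝ) (z : R) (a : ℕ) (v : R × R × R) : ℕ → R × R × R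
  | 0 => v
  | i + 1 => if i + 1 ≤ a then v else step (l i) (m (i + 1)) z (orbit l m z a v i)

theorem orbit_self (l m : ℕ → ℝ) (z : R) (a : ℕ) (v : R × R × R) : orbit l m z a v a = v := by
  cases a <;> simp [orbit]

theorem orbit_succ (l m : ℕ → ℝ) (z : R) {a i : ℕ} (h : a ≤ i) (v : R × R × R) :
    orbit l m z a v (i + 1) = step (l i) (m (i + 1)) z (orbit l m z a v i) := by
  rw [orbit, if_neg (by omega)]

/-- The bilinear form `φ ψ'' - φ' ψ' + φ'' ψ`. -/
def pairing (u v : R × R × R) : R := u.1 * v.2.2 - u.2.1 * v.2.1 + u.2.2 * v.1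

/-- The `2 × 2` minors of a pair of states. -/
def wedge (u v : R × R × R) : R × R × R :=
  (u.1 * v.2.1 - u.2.1 * v.1, u.1 * v.2.2 - u.2.2 * v.1, u.2.1 * v.2.2 - u.2.2 * v.2.1)

theorem two_mul_algebraMap_sq_div_two (l : ℝ) :
    2 * algebraMap ℝ R (l ^ 2 / 2) = algebraMap ℝ R l ^ 2 := by
  rw [← map_pow, ← map_ofNat (algebraMap ℝ R) 2, ← map_mul]
  congr 1
  ring

/-- Discrete form of `(φψ'' - φ'ψ' + φ''ψ)' = φψ''' + φ'''ψ`, which vanishes when the parameters are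
opposite. -/
theorem pairing_step (l m : ℝ) (z : R) (u v : R × R × R) :
    pairing (step l m z u) (step l m (-z) v) = pairing u v := by
  have h := two_mul_algebraMap_sq_div_two (R := R) l
  simp only [pairing, step, Algebra.smul_def]
  linear_combination (u.2.2 * v.2.2) * h

/-- With `w = φψ' - φ'ψ` one has `w' = φψ'' - φ''ψ`, `w'' = φ'ψ'' - φ''ψ'` because the terms `φψ'''
- φ'''ψ` cancel, and `w''' = z m w`. -/
theorem wedge_step (l m : ℝ) (z : R) (u v : R × R × R) :
    wedge (step l m z u) (step l m z v) = step l m (-z) (wedge u v) := by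
  have h := two_mul_algebraMap_sq_div_two (R := R) l
  simp only [wedge, step, Algebra.smul_def]
  ext
  · linear_combination -(u.2.1 * v.2.2 - u.2.2 * v.2.1) * h
  · ring
  · linear_combination -(algebraMap ℝ R (2 * m)) * z * (u.2.1 * v.2.2 - u.2.2 * v.2.1) * h

theorem pairing_orbit (l m : ℕ → ℝ) (z : R) {a c i : ℕ} (hc : c ≤ a) (hi : a ≤ i)
    (u v : R × R × R) :
    pairing (orbit l m z c u i) (orbit l m (-z) a v i) = pairing (orbit l m z c u a) v := by
  induction i, hi using Nat.le_induction with
  | base => rw [orbit_self]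
  | succ i hi ih => rw [orbit_succ _ _ _ (hc.trans hi), orbit_succ _ _ _ hi, pairing_step, ih]

theorem wedge_orbit (l m : ℕ → ℝ) (z : R) {a c i : ℕ} (hc : c ≤ a) (hi : a ≤ i)
    (u v : R × R × R) :
    wedge (orbit l m z c u i) (orbit l m z a v i) =
      orbit l m (-z) a (wedge (orbit l m z c u a) v) i := by
  induction i, hi using Nat.le_induction with
  | base => rw [orbit_self, orbit_self]
  | succ i hi ih =>
    rw [orbit_succ _ _ _ (hc.trans hi), orbit_succ _ _ _ hi, orbit_succ _ _ _ hi, wedge_step, ih]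

theorem orbit_map {S : Type*} [CommRing S] [Algebra ℝ S] (F : R →ₐ[ℝ] S) (l m : ℕ → ℝ) (z : R)
    (a : ℕ) (v : R × R × R) (i : ℕ) :
    orbit l m (F z) a (F v.1, F v.2.1, F v.2.2) i =
      (F (orbit l m z a v i).1, F (orbit l m z a v i).2.1, F (orbit l m z a v i).2.2) := by
  induction i with
  | zero => rfl
  | succ i ih =>
    simp only [orbit, ih]
    split_ifs
    · rfl
    · simp [step]

end Ring

/-! ### Degrees, leading and lowest coefficients of the polynomial solutions. -/

section Degree

variable (l m : ℕ → ℝ)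

theorem step_natDegree_le {l m : ℝ} {z : ℝ[X]} (hz : z.natDegree ≤ 1) {d : ℕ}
    {u : ℝ[X] × ℝ[X] × ℝ[X]}
    (h1 : u.1.natDegree ≤ d) (h2 : u.2.1.natDegree ≤ d) (h3 : u.2.2.natDegree ≤ d) :
    (step l m z u).1.natDegree ≤ d ∧ (step l m z u).2.1.natDegree ≤ d ∧
      (step l m z u).2.2.natDegree ≤ d + 1 := by
  have hs : ∀ (c : ℝ) (p : ℝ[X]) (n : ℕ), p.natDegree ≤ n → (c • p).natDegree ≤ n :=
    fun c p n hp => (natDegree_smul_le c p).trans hp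
  have hf : (step l m z u).1.natDegree ≤ d :=
    natDegree_add_le_of_degree_le (natDegree_add_le_of_degree_le h1 (hs _ _ _ h2)) (hs _ _ _ h3)
  refine ⟨hf, natDegree_add_le_of_degree_le h2 (hs _ _ _ h3), ?_⟩
  refine (natDegree_sub_le _ _).trans (max_le (h3.trans (Nat.le_succ d)) (hs _ _ _ ?_))
  exact natDegree_mul_le.trans (by rw [add_comm d]; exact add_le_add hz hf)

theorem orbit_natDegree_le {z : ℝ[X]} (hz : z.natDegree ≤ 1) {a i d : ℕ} (hi : a ≤ i)
    {v : ℝ[X] × ℝ[X] × ℝ[X]}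
    (h1 : v.1.natDegree ≤ d) (h2 : v.2.1.natDegree ≤ d) (h3 : v.2.2.natDegree ≤ d) :
    (orbit l m z a v i).1.natDegree ≤ d + (i - a) ∧
      (orbit l m z a v i).2.1.natDegree ≤ d + (i - a) ∧
      (orbit l m z a v i).2.2.natDegree ≤ d + (i - a) := by
  induction i, hi using Nat.le_induction with
  | base => simpa [orbit_self] using ⟨h1, h2, h3⟩
  | succ i hi ih =>
    rw [orbit_succ _ _ _ hi]
    obtain ⟨k1, k2, k3⟩ := step_natDegree_le (l := l i) (m := m (i + 1)) hz ih.1 ih.2.1 ih.2.2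
    have : d + (i + 1 - a) = d + (i - a) + 1 := by omega
    rw [this]
    exact ⟨k1.trans (Nat.le_succ _), k2.trans (Nat.le_succ _), k3⟩

/-- The polynomial solution with initial state `(1, 0, 0)` to the left of all masses. -/
noncomputable def phi : ℕ → ℝ[X] × ℝ[X] × ℝ[X] :=
  orbit l m X 0 (1, 0, -(2 * m 0) • X)

/-- The polynomial solution with state `(0, 0, 1)` at the mass with index `a`. -/
noncomputable def psi (a : ℕ) : ℕ → ℝ[X] × ℝ[X] × ℝ[X] :=
  orbit l m X a (0, 0, 1)

theorem phi_succ (i : ℕ) : phi l m (i + 1) = step (l i) (m (i + 1)) X (phi l m i) :=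
  orbit_succ _ _ _ (Nat.zero_le i) _

theorem psi_succ {a i : ℕ} (h : a ≤ i) :
    psi l m a (i + 1) = step (l i) (m (i + 1)) X (psi l m a i) :=
  orbit_succ _ _ _ h _

theorem psi_self (a : ℕ) : psi l m a a = (0, 0, 1) := orbit_self _ _ _ _ _

theorem phi_natDegree_le (i : ℕ) :
    (phi l m i).1.natDegree ≤ i ∧ (phi l m i).2.1.natDegree ≤ i ∧
      (phi l m i).2.2.natDegree ≤ i + 1 := by
  induction i with
  | zero =>
    refine ⟨by simp [phi, orbit], by simp [phi, orbit], ?_⟩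
    exact (natDegree_smul_le _ _).trans natDegree_X_le
  | succ i ih =>
    rw [phi_succ]
    exact step_natDegree_le natDegree_X_le (ih.1.trans i.le_succ) (ih.2.1.trans i.le_succ) ih.2.2

theorem psi_natDegree_le {a i : ℕ} (h : a ≤ i) :
    (psi l m a i).1.natDegree ≤ i - a ∧ (psi l m a i).2.1.natDegree ≤ i - a ∧
      (psi l m a i).2.2.natDegree ≤ i - a := by
  simpa [psi] using orbit_natDegree_le l m natDegree_X_le h (d := 0) (v := (0, 0, 1))
    (by simp) (by simp) (by simp)

/-- When `φ''` dominates, the gap contributes `l²/2` times its top coefficient to `φ`, and the mass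
multiplies this by `-2mX`. -/
theorem step_coeff_top (l m : ℝ) {e : ℕ} {u : ℝ[X] × ℝ[X] × ℝ[X]}
    (h1 : ∀ n, e ≤ n → u.1.coeff n = 0) (h2 : ∀ n, e ≤ n → u.2.1.coeff n = 0)
    (h3 : ∀ n, e < n → u.2.2.coeff n = 0) :
    (∀ n, e + 1 ≤ n → (step l m X u).1.coeff n = 0) ∧
    (∀ n, e + 1 ≤ n → (step l m X u).2.1.coeff n = 0) ∧
    (∀ n, e + 1 < n → (step l m X u).2.2.coeff n = 0) ∧
    (step l m X u).2.2.coeff (e + 1) = -(m * l ^ 2) * u.2.2.coeff e := by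
  have hf : ∀ n, e + 1 ≤ n → (step l m X u).1.coeff n = 0 := fun n hn => by
    simp [step, h1 n (by omega), h2 n (by omega), h3 n (by omega)]
  have hg : ∀ n, e + 1 ≤ n → (step l m X u).2.1.coeff n = 0 := fun n hn => by
    simp [step, h2 n (by omega), h3 n (by omega)]
  refine ⟨hf, hg, fun n hn => ?_, ?_⟩
  · obtain ⟨n, rfl⟩ : ∃ k, n = k + 1 := ⟨n - 1, by omega⟩
    simp [step, h1 n (by omega), h2 n (by omega), h3 n (by omega), h3 (n + 1) (by omega)]
  · simp [step, h1 e le_rfl, h2 e le_rfl, h3 (e + 1) (by omega)]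
    ring

/-- The product of the factors `-m l²` by which the leading coefficient grows. -/
noncomputable def growth (a i : ℕ) : ℝ := ∏ j ∈ Finset.Ico a i, -(m (j + 1) * l j ^ 2)

theorem orbit_coeff_top {a i e : ℕ} (hi : a ≤ i) {v : ℝ[X] × ℝ[X] × ℝ[X]}
    (h1 : ∀ n, e ≤ n → v.1.coeff n = 0) (h2 : ∀ n, e ≤ n → v.2.1.coeff n = 0)
    (h3 : ∀ n, e < n → v.2.2.coeff n = 0) :
    (orbit l m X a v i).2.2.coeff (e + (i - a)) = growth l m a i * v.2.2.coeff e := by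
  suffices h : (∀ n, e + (i - a) ≤ n → (orbit l m X a v i).1.coeff n = 0) ∧
      (∀ n, e + (i - a) ≤ n → (orbit l m X a v i).2.1.coeff n = 0) ∧
      (∀ n, e + (i - a) < n → (orbit l m X a v i).2.2.coeff n = 0) ∧
      (orbit l m X a v i).2.2.coeff (e + (i - a)) = growth l m a i * v.2.2.coeff e from h.2.2.2
  induction i, hi using Nat.le_induction with
  | base => simpa [orbit_self, growth] using ⟨h1, h2, h3⟩
  | succ i hi ih =>
    rw [orbit_succ _ _ _ hi, show e + (i + 1 - a) = e + (i - a) + 1 by omega]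
    obtain ⟨k1, k2, k3, k4⟩ := step_coeff_top (l i) (m (i + 1)) ih.1 ih.2.1 ih.2.2.1
    refine ⟨k1, k2, k3, ?_⟩
    rw [k4, ih.2.2.2, growth, growth, Finset.prod_Ico_succ_top hi]
    ring

theorem psi_coeff_top {a i : ℕ} (h : a ≤ i) :
    (psi l m a i).2.2.coeff (i - a) = growth l m a i := by
  have := orbit_coeff_top l m h (e := 0) (v := (0, 0, 1)) (by simp) (by simp)
    (fun n hn => by simp [coeff_one]; omega)
  simpa [psi] using this

theorem phi_coeff_zero (i : ℕ) :
    (phi l m i).1.coeff 0 = 1 ∧ (phi l m i).2.1.coeff 0 = 0 ∧ (phi l m i).2.2.coeff 0 = 0 ∧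
      (phi l m i).2.2.coeff 1 = -2 * ∑ j ∈ Finset.range (i + 1), m j := by
  induction i with
  | zero => simp [phi, orbit]
  | succ i ih =>
    obtain ⟨h1, h2, h3, h4⟩ := ih
    rw [phi_succ, Finset.sum_range_succ]
    have hX : ∀ p : ℝ[X], (X * p).coeff 1 = p.coeff 0 := fun p => coeff_X_mul p 0
    simp [step, h1, h2, h3, h4, hX]
    ring

theorem psi_coeff_zero {a i : ℕ} (h : a ≤ i) :
    (psi l m a i).2.1.coeff 0 = ∑ j ∈ Finset.Ico a i, l j ∧ (psi l m a i).2.2.coeff 0 = 1 := by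
  induction i, h using Nat.le_induction with
  | base => simp [psi_self]
  | succ i hi ih =>
    rw [psi_succ l m hi, Finset.sum_Ico_succ_top hi]
    simp [step, ih]

theorem phi_coeff_step (i : ℕ) :
    (phi l m i).2.2.coeff (i + 1) = -(2 * m i) * (phi l m i).1.coeff i := by
  cases i with
  | zero => simp [phi, orbit]
  | succ i =>
    rw [phi_succ]
    have h := (phi_natDegree_le l m i).2.2
    simp [step, coeff_eq_zero_of_natDegree_lt (show (phi l m i).2.2.natDegree < i + 1 + 1 by omega)]

theorem phi_coeff_top {a i : ℕ} (h : a ≤ i) :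
    (phi l m i).2.2.coeff (i + 1) = growth l m a i * (-(2 * m a) * (phi l m a).1.coeff a) := by
  have hrestart : phi l m i = orbit l m X a (phi l m a) i := by
    induction i, h using Nat.le_induction with
    | base => rw [orbit_self]
    | succ i hi ih => rw [phi_succ, orbit_succ _ _ _ hi, ih]
  obtain ⟨d1, d2, d3⟩ := phi_natDegree_le l m a
  have := orbit_coeff_top l m h (e := a + 1) (v := phi l m a)
    (fun n hn => coeff_eq_zero_of_natDegree_lt (by omega))
    (fun n hn => coeff_eq_zero_of_natDegree_lt (by omega))
    (fun n hn => coeff_eq_zero_of_natDegree_lt (by omega))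
  rw [show a + 1 + (i - a) = i + 1 by omega, ← hrestart, phi_coeff_step l m a] at this
  exact this

theorem growth_ne_zero {a i : ℕ} (hm : ∀ j < i, m (j + 1) ≠ 0) (hl : ∀ j < i, l j ≠ 0) :
    growth l m a i ≠ 0 := by
  refine Finset.prod_ne_zero_iff.2 fun j hj => ?_
  rw [Finset.mem_Ico] at hj
  exact neg_ne_zero.2 (mul_ne_zero (hm j hj.2) (pow_ne_zero 2 (hl j hj.2)))

/-- The pairing is constant in `i`, and at the first mass the terms `±2 m₀ x` cancel. -/
theorem phi_pairing_eval (i : ℕ) (x : ℝ) :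
    (phi l m i).1.eval x * (phi l m i).2.2.eval (-x)
      - (phi l m i).2.1.eval x * (phi l m i).2.1.eval (-x)
      + (phi l m i).2.2.eval x * (phi l m i).1.eval (-x) = 0 := by
  have h1 := orbit_map (aeval x) l m X 0 (1, 0, -(2 * m 0) • (X : ℝ[X])) i
  have h2 := orbit_map (aeval (-x)) l m X 0 (1, 0, -(2 * m 0) • (X : ℝ[X])) i
  have h := pairing_orbit l m x le_rfl (Nat.zero_le i) (1, 0, -(2 * m 0) • x)
    (1, 0, -(2 * m 0) • (-x))
  simp [pairing, orbit_self] at h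
  simp [coe_aeval_eq_eval] at h1 h2
  rw [h1, h2] at h
  simpa [phi] using h

/-- At mass `a` the pairing with `(0, 0, 1)` leaves only the first component of `phi`. -/
theorem phi_psi_pairing_eval {a i : ℕ} (hi : a ≤ i) (x : ℝ) :
    (phi l m i).1.eval x * (psi l m a i).2.2.eval (-x)
      - (phi l m i).2.1.eval x * (psi l m a i).2.1.eval (-x)
      + (phi l m i).2.2.eval x * (psi l m a i).1.eval (-x) = (phi l m a).1.eval x := by
  have h0 := orbit_map (aeval x) l m X 0 (1, 0, -(2 * m 0) • (X : ℝ[X])) a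
  have h1 := orbit_map (aeval x) l m X 0 (1, 0, -(2 * m 0) • (X : ℝ[X])) i
  have h2 := orbit_map (aeval (-x)) l m X a (0, 0, (1 : ℝ[X])) i
  have h := pairing_orbit l m x (Nat.zero_le a) hi (1, 0, -(2 * m 0) • x) (0, 0, 1)
  simp [pairing] at h
  simp [coe_aeval_eq_eval] at h0 h1 h2
  rw [h0, h1, h2] at h
  simpa [phi, psi] using h

/-- Bounding the two products separately is too weak. The minor is a component of a solution at `-X`
that starts at `a` from `(0, φ, φ')`, of degree at most `a`, and gains at most one degree per mass.
-/
theorem phi_psi_minor_natDegree_le {a i : ℕ} (h : a ≤ i) :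
    ((phi l m i).2.1 * (psi l m a i).2.2 - (phi l m i).2.2 * (psi l m a i).2.1).natDegree ≤ i := by
  have hw := wedge_orbit l m (X : ℝ[X]) (Nat.zero_le a) h (1, 0, -(2 * m 0) • X) (0, 0, 1)
  obtain ⟨d1, d2, d3⟩ := phi_natDegree_le l m a
  have := orbit_natDegree_le l m (z := -X) (by simp) h (d := a)
    (v := wedge (phi l m a) (0, 0, 1)) (by simp [wedge]) (by simpa [wedge] using d1)
    (by simpa [wedge] using d2)
  rw [show a + (i - a) = i by omega] at this
  have h3 := this.2.2
  unfold phi at h3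
  rw [← hw] at h3
  exact h3

end Degree

end CubicOrbit

namespace CubicOrbit

open Polynomial

/-! ### Determinants under a triangular change of polynomial basis. -/

section Det

theorem linearMap_eq_sum_coeff {k : ℕ} (ℓ : ℝ[X] →ₗ[ℝ] ℝ) {p : ℝ[X]} (hp : p.natDegree < k) :
    ℓ p = ∑ r : Fin k, p.coeff r * ℓ (X ^ (r : ℕ)) := by
  conv_lhs => rw [p.as_sum_range' k hp]
  rw [map_sum, Finset.sum_range]
  refine Finset.sum_congr rfl fun r _ => ?_
  rw [← C_mul_X_pow_eq_monomial, ← smul_eq_C_mul, map_smul, smul_eq_mul]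

theorem prod_coeff_mul_det {k : ℕ} (ℓ : Fin k → ℝ[X] →ₗ[ℝ] ℝ) (p : Fin k → ℝ[X])
    (hp : ∀ i, (p i).natDegree ≤ i) :
    (∏ i, (p i).coeff i) * (Matrix.of fun i j : Fin k => ℓ j (X ^ (i : ℕ))).det =
      (Matrix.of fun i j : Fin k => ℓ j (p i)).det := by
  have hC : (Matrix.of fun i j : Fin k => (p i).coeff j).det = ∏ i, (p i).coeff i := by
    refine (Matrix.det_of_isLowerTriangular _ fun i j hij => ?_)
    have hij' : (i : ℕ) < j := hij
    exact coeff_eq_zero_of_natDegree_lt ((hp i).trans_lt hij')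
  rw [← hC, ← Matrix.det_mul]
  congr 1
  ext i j
  rw [Matrix.mul_apply]
  exact (linearMap_eq_sum_coeff (ℓ j) ((hp i).trans_lt i.2)).symm

end Det

/-! ### Residue sums at the zeros of the last second derivative. -/

section Residue

variable {N : ℕ} {ev b : Fin N → ℝ} {M : ℝ}

/-- `∫ f(κ) λ^j / (κ + λ) dμ(κ) dμ(λ)`, linear in `f`. -/
noncomputable def biform (ev b : Fin N → ℝ) (j : ℕ) : ℝ[X] →ₗ[ℝ] ℝ where
  toFun f := ∑ p, ∑ q, b p * b q * (f.eval (ev p) * ev q ^ j / (ev p + ev q))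
  map_add' f g := by
    simp only [← Finset.sum_add_distrib, eval_add]
    exact Finset.sum_congr rfl fun p _ => Finset.sum_congr rfl fun q _ => by ring
  map_smul' c f := by
    simp only [Finset.mul_sum, eval_smul, smul_eq_mul, RingHom.id_apply]
    exact Finset.sum_congr rfl fun p _ => Finset.sum_congr rfl fun q _ => by ring

/-- `biform` with the extra term `f(0) / (2M)` for `j = 0`. -/
noncomputable def biformA (ev b : Fin N → ℝ) (M : ℝ) (j : ℕ) : ℝ[X] →ₗ[ℝ] ℝ :=
  biform ev b j + (if j = 0 then 1 / (2 * M) else 0 : ℝ) • lcoeff ℝ 0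

/-- `∫ f dμ`. -/
noncomputable def moment (ev b : Fin N → ℝ) : ℝ[X] →ₗ[ℝ] ℝ where
  toFun f := ∑ p, b p * f.eval (ev p)
  map_add' f g := by simp [mul_add, Finset.sum_add_distrib]
  map_smul' c f := by
    simp only [Finset.mul_sum, eval_smul, smul_eq_mul, RingHom.id_apply]
    exact Finset.sum_congr rfl fun p _ => by ring

variable {l m : ℕ → ℝ}

/-- The sum of the finite residues of `g / (c · nodal)`, read off from the top coefficient of the
Lagrange interpolant. -/
theorem sum_eval_div_derivative {r : Fin (N + 1) → ℝ} (hr : Function.Injective r) {c : ℝ}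
    {g : ℝ[X]} (hg : g.natDegree ≤ N) :
    ∑ i, g.eval (r i) / (derivative (C c * Lagrange.nodal Finset.univ r)).eval (r i) =
      g.coeff N / c := by
  have hd : g.degree < (Finset.univ : Finset (Fin (N + 1))).card := by
    rw [Finset.card_univ, Fintype.card_fin]
    exact degree_le_natDegree.trans_lt (by exact_mod_cast Nat.lt_succ_of_le hg)
  have h := Lagrange.coeff_eq_sum hr.injOn hd
  rw [Finset.card_univ, Fintype.card_fin, Nat.add_sub_cancel] at h
  rw [h, Finset.sum_div]
  refine Finset.sum_congr rfl fun i hi => ?_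
  rw [derivative_C_mul, eval_mul, eval_C, Lagrange.eval_nodal_derivative_eval_node_eq hi,
    Lagrange.eval_nodal, div_div, mul_comm c]

theorem eval_div_eq_sum {r : Fin (N + 1) → ℝ} (hr : Function.Injective r) {c : ℝ} (hc : c ≠ 0)
    {g : ℝ[X]} (hg : g.natDegree ≤ N) {x : ℝ} (hx : ∀ i, x ≠ r i) :
    g.eval x = (C c * Lagrange.nodal Finset.univ r).eval x * ∑ i, g.eval (r i) /
      (derivative (C c * Lagrange.nodal Finset.univ r)).eval (r i) / (x - r i) := by
  have hd : g.degree < (Finset.univ : Finset (Fin (N + 1))).card := by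
    rw [Finset.card_univ, Fintype.card_fin]
    exact degree_le_natDegree.trans_lt (by exact_mod_cast Nat.lt_succ_of_le hg)
  have h := Lagrange.eval_interpolate_not_at_node (s := Finset.univ) (v := r)
    (fun i => g.eval (r i)) (x := x) (fun i _ => hx i)
  rw [← Lagrange.eq_interpolate hr.injOn hd] at h
  rw [h, eval_mul, eval_C, mul_comm c, mul_assoc, Finset.mul_sum (a := c)]
  congr 1
  refine Finset.sum_congr rfl fun i hi => ?_
  rw [Lagrange.nodalWeight_eq_eval_derivative_nodal hi, derivative_C_mul, eval_mul, eval_C]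
  field_simp

/-- `ev`, `b`, `M` are the spectral data of the polynomial solution `phi`. -/
structure IsSpectral {N : ℕ} (l m : ℕ → ℝ) (ev b : Fin N → ℝ) (M : ℝ) : Prop where
  mass_pos : ∀ i ≤ N, 0 < m i
  gap_pos : ∀ i < N, 0 < l i
  ev_pos : ∀ q, 0 < ev q
  ev_inj : Function.Injective ev
  eval_eq_zero : ∀ q, (phi l m N).2.2.eval (ev q) = 0
  weyl : ∀ x, x ≠ 0 → (∀ q, x ≠ ev q) →
    (phi l m N).2.1.eval x = (phi l m N).2.2.eval x * ∑ q, b q / (x - ev q)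
  mass_sum : M = ∑ i ∈ Finset.range (N + 1), m i

namespace IsSpectral

/-- The zeros of `φ''(xₙ+)`. -/
def nodes (ev : Fin N → ℝ) : Fin (N + 1) → ℝ := Fin.cons 0 ev

variable (h : IsSpectral l m ev b M)

include h

theorem growth_ne_zero {a i : ℕ} (hi : i ≤ N) : growth l m a i ≠ 0 :=
  CubicOrbit.growth_ne_zero l m (fun j hj => (h.mass_pos _ (by omega)).ne')
    (fun j hj => (h.gap_pos j (by omega)).ne')

theorem nodes_injective : Function.Injective (nodes ev) :=
  Fin.cons_injective_iff.2 ⟨fun ⟨q, hq⟩ => (h.ev_pos q).ne' hq, h.ev_inj⟩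

theorem phi_coeff_top_ne_zero : (phi l m N).2.2.coeff (N + 1) ≠ 0 := by
  rw [phi_coeff_top l m (Nat.zero_le N), (phi_coeff_zero l m 0).1]
  have := (h.mass_pos 0 (Nat.zero_le N)).ne'
  have := h.growth_ne_zero (a := 0) le_rfl
  simp [*]

theorem total_mass_pos : 0 < M := by
  rw [h.mass_sum]
  exact Finset.sum_pos (fun i hi => h.mass_pos i (by simpa [Nat.lt_succ_iff] using hi)) (by simp)

theorem phi_eq_nodal :
    (phi l m N).2.2 = C ((phi l m N).2.2.coeff (N + 1)) * Lagrange.nodal Finset.univ (nodes ev) := by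
  have hnod : (Lagrange.nodal Finset.univ (nodes ev)).natDegree = N + 1 := by
    rw [Lagrange.natDegree_nodal, Finset.card_univ, Fintype.card_fin]
  refine eq_of_degree_sub_lt_of_eval_index_eq (s := Finset.univ) (v := nodes ev)
    h.nodes_injective.injOn ?_ ?_
  · rw [Finset.card_univ, Fintype.card_fin, degree_lt_iff_coeff_zero]
    intro n hn
    rcases hn.eq_or_lt with rfl | hn
    · have h1 : (Lagrange.nodal Finset.univ (nodes ev)).coeff (N + 1) = 1 := by
        have hmon := (Lagrange.nodal_monic (s := Finset.univ) (v := nodes ev)).coeff_natDegree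
        rwa [hnod] at hmon
      simp [h1]
    · rw [coeff_sub, coeff_C_mul,
        coeff_eq_zero_of_natDegree_lt (p := Lagrange.nodal _ _) (by rw [hnod]; exact hn),
        coeff_eq_zero_of_natDegree_lt (((phi_natDegree_le l m N).2.2).trans_lt hn)]
      simp
  · intro i hi
    rw [eval_mul, Lagrange.eval_nodal_at_node hi, mul_zero]
    refine Fin.cases ?_ (fun q => ?_) i
    · rw [nodes, Fin.cons_zero, ← coeff_zero_eq_eval_zero]
      exact (phi_coeff_zero l m N).2.2.1
    · exact h.eval_eq_zero q

theorem derivative_eval_ne_zero (i : Fin (N + 1)) :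
    (derivative (phi l m N).2.2).eval (nodes ev i) ≠ 0 := by
  rw [h.phi_eq_nodal, derivative_C_mul, eval_mul, eval_C,
    Lagrange.eval_nodal_derivative_eval_node_eq (Finset.mem_univ i), Lagrange.eval_nodal]
  refine mul_ne_zero h.phi_coeff_top_ne_zero (Finset.prod_ne_zero_iff.2 fun j hj => ?_)
  exact sub_ne_zero.2 fun hij => (Finset.mem_erase.1 hj).1 (h.nodes_injective hij).symm

theorem derivative_eval_zero : (derivative (phi l m N).2.2).eval 0 = -2 * M := by
  rw [← coeff_zero_eq_eval_zero, coeff_derivative]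
  simp [(phi_coeff_zero l m N).2.2.2, h.mass_sum]

theorem sum_residues {g : ℝ[X]} (hg : g.natDegree ≤ N) :
    g.eval 0 / (-2 * M) + ∑ q, g.eval (ev q) / (derivative (phi l m N).2.2).eval (ev q) =
      g.coeff N / (phi l m N).2.2.coeff (N + 1) := by
  have hs := sum_eval_div_derivative h.nodes_injective (c := (phi l m N).2.2.coeff (N + 1)) hg
  rw [← h.phi_eq_nodal, Fin.sum_univ_succ] at hs
  simpa [nodes, h.derivative_eval_zero] using hs

theorem partial_fractions {g : ℝ[X]} (hg : g.natDegree ≤ N) (h0 : g.eval 0 = 0) {x : ℝ}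
    (hx0 : x ≠ 0) (hx : ∀ q, x ≠ ev q) :
    g.eval x = (phi l m N).2.2.eval x *
      ∑ q, g.eval (ev q) / (derivative (phi l m N).2.2).eval (ev q) / (x - ev q) := by
  have hs := eval_div_eq_sum h.nodes_injective h.phi_coeff_top_ne_zero hg (x := x)
    (fun i => by refine Fin.cases ?_ (fun q => ?_) i <;> simp [nodes, hx0, hx])
  rw [← h.phi_eq_nodal, Fin.sum_univ_succ] at hs
  simpa [nodes, h0] using hs

theorem phi_eval_ne_zero {x : ℝ} (hx0 : x ≠ 0) (hx : ∀ q, x ≠ ev q) :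
    (phi l m N).2.2.eval x ≠ 0 := by
  rw [h.phi_eq_nodal, eval_mul, eval_C]
  refine mul_ne_zero h.phi_coeff_top_ne_zero (Lagrange.eval_nodal_not_at_node fun i _ => ?_)
  refine Fin.cases ?_ (fun q => ?_) i <;> simp [nodes, hx0, hx]

/-- No residue appears at `0`: clearing denominators in the Weyl function leaves a factor `X` in
both `φ'` and `φ''`. -/
theorem residue_eq (q : Fin N) :
    (phi l m N).2.1.eval (ev q) = b q * (derivative (phi l m N).2.2).eval (ev q) := by
  set c := (phi l m N).2.2.coeff (N + 1)
  have hphi : (phi l m N).2.2 = C c * (X * Lagrange.nodal Finset.univ ev) := by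
    refine h.phi_eq_nodal.trans ?_
    rw [Lagrange.nodal, Lagrange.nodal, Fin.prod_univ_succ]
    simp [nodes, c]
  have hid : (phi l m N).2.1 =
      ∑ p, C (c * b p) * (X * Lagrange.nodal (Finset.univ.erase p) ev) := by
    -- The Weyl identity is known only off the nodes, but a cofinite set of points determines a
    -- polynomial.
    have hfin : (insert 0 (Set.range ev)).Finite := (Set.finite_range ev).insert 0
    refine eq_of_infinite_eval_eq _ _ (hfin.infinite_compl.mono fun x hx => ?_)
    simp only [Set.mem_compl_iff, Set.mem_insert_iff, Set.mem_range, not_or, not_exists] at hx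
    rw [Set.mem_ofPred_eq, h.weyl x hx.1 (fun p hp => hx.2 p hp.symm), hphi, Finset.mul_sum,
      eval_finsetSum]
    refine Finset.sum_congr rfl fun p hp => ?_
    have hne : x - ev p ≠ 0 := sub_ne_zero.2 fun hp => hx.2 p hp.symm
    rw [Lagrange.nodal_eq_mul_nodal_erase hp]
    simp only [eval_mul, eval_C, eval_X, eval_sub]
    field_simp
  have hd : (derivative (phi l m N).2.2).eval (ev q) =
      c * (ev q * (Lagrange.nodal (Finset.univ.erase q) ev).eval (ev q)) := by
    rw [hphi, derivative_C_mul, derivative_mul]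
    simp [Lagrange.eval_nodal_derivative_eval_node_eq (Finset.mem_univ q),
      Lagrange.eval_nodal_at_node (Finset.mem_univ q)]
  rw [hd, hid, eval_finsetSum, Finset.sum_eq_single q]
  · simp
    ring
  · intro p _ hpq
    rw [eval_mul, eval_mul, Lagrange.eval_nodal_at_node (Finset.mem_erase.2
      ⟨hpq.symm, Finset.mem_univ q⟩), mul_zero, mul_zero]
  · simp

/-- The polynomial `φ' ψ'' - φ'' ψ'` at the last mass, with `ψ = psi a`. -/
noncomputable def minor (l m : ℕ → ℝ) (N a : ℕ) : ℝ[X] :=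
  (phi l m N).2.1 * (psi l m a N).2.2 - (phi l m N).2.2 * (psi l m a N).2.1

theorem minor_eval_div (a : ℕ) (q : Fin N) :
    (minor l m N a).eval (ev q) / (derivative (phi l m N).2.2).eval (ev q) =
      b q * (psi l m a N).2.2.eval (ev q) := by
  have hd : (derivative (phi l m N).2.2).eval (ev q) ≠ 0 := h.derivative_eval_ne_zero q.succ
  rw [minor, eval_sub, eval_mul, eval_mul, h.eval_eq_zero, h.residue_eq]
  field_simp
  ring

/-- At `ev q` the terms with `φ''` drop out of both pairings. Eliminating `φ` between them gives
`φ''(-ev q) φ_a(ev q) = φ'(ev q) · minor(-ev q)`; expanding `minor / φ''` in partial fractions at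
`-ev q` produces the kernel `1 / (ev p + ev q)`. -/
theorem phi_div_derivative {a : ℕ} (ha : a ≤ N) (q : Fin N) :
    (phi l m a).1.eval (ev q) / (derivative (phi l m N).2.2).eval (ev q) =
      -∑ p, b p * b q * ((psi l m a N).2.2.eval (ev p) / (ev p + ev q)) := by
  have hd : (derivative (phi l m N).2.2).eval (ev q) ≠ 0 := h.derivative_eval_ne_zero q.succ
  have hneg : ∀ p, -ev q ≠ ev p := fun p => by linarith [h.ev_pos p, h.ev_pos q]
  have h0 : -ev q ≠ 0 := neg_ne_zero.2 (h.ev_pos q).ne'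
  have hx := h.phi_eval_ne_zero h0 hneg
  have hpf := h.partial_fractions (phi_psi_minor_natDegree_le l m ha)
    (by simp [← coeff_zero_eq_eval_zero, phi_coeff_zero l m N]) h0 hneg
  have e1 := phi_psi_pairing_eval l m ha (ev q)
  have e2 := phi_pairing_eval l m N (ev q)
  change (minor l m N a).eval (-ev q) = _ * ∑ p, (minor l m N a).eval (ev p) / _ / _ at hpf
  simp only [h.minor_eval_div] at hpf
  rw [h.eval_eq_zero] at e1 e2
  have hfin : (phi l m a).1.eval (ev q) = b q * (derivative (phi l m N).2.2).eval (ev q) *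
      ∑ p, b p * (psi l m a N).2.2.eval (ev p) / (-ev q - ev p) := by
    refine mul_left_cancel₀ hx ?_
    rw [← h.residue_eq]
    rw [minor, eval_sub, eval_mul, eval_mul] at hpf
    linear_combination (-(phi l m N).2.2.eval (-ev q)) * e1
      + (psi l m a N).2.2.eval (-ev q) * e2 + (phi l m N).2.1.eval (ev q) * hpf
  rw [hfin, mul_comm (b q), mul_assoc, mul_div_cancel_left₀ _ hd, Finset.mul_sum,
    ← Finset.sum_neg_distrib]
  refine Finset.sum_congr rfl fun p _ => ?_
  rw [show -ev q - ev p = -(ev p + ev q) by ring, div_neg]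
  ring

/-- The residue theorem for `X^j φ_a / φ''`. The residue at `0` is nonzero only for `j = 0`, where
it is `-1/(2M)`; the bound on `j` keeps the numerator of degree at most `N`. -/
theorem biformA_psi {a j : ℕ} (ha : a ≤ N) (hj : j ≤ N - a) :
    biformA ev b M j (psi l m a N).2.2 =
      -((X ^ j * (phi l m a).1).coeff N / (phi l m N).2.2.coeff (N + 1)) := by
  have hdeg : (X ^ j * (phi l m a).1).natDegree ≤ N := by
    refine natDegree_mul_le.trans ?_
    have := (phi_natDegree_le l m a).1
    rw [natDegree_X_pow]
    omega
  have hM := h.total_mass_pos.ne'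
  rw [← h.sum_residues hdeg]
  simp only [eval_mul, mul_div_assoc, h.phi_div_derivative ha, eval_pow, eval_X]
  simp only [biformA, biform, LinearMap.add_apply, LinearMap.coe_mk, AddHom.coe_mk,
    LinearMap.smul_apply, lcoeff_apply, (psi_coeff_zero l m ha).2]
  rw [Finset.sum_comm, neg_add, add_comm, ← Finset.sum_neg_distrib]
  congr 1
  · rw [← coeff_zero_eq_eval_zero, (phi_coeff_zero l m a).1]
    rcases Nat.eq_zero_or_pos j with rfl | hj0
    · simp
    · simp [hj0.ne']
  · refine Finset.sum_congr rfl fun q _ => ?_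
    rw [mul_neg, neg_neg, Finset.mul_sum]
    exact Finset.sum_congr rfl fun p _ => by ring

/-- The residue theorem for `minor / (X φ'')`. Only the gap sum depends on `a`, so differences in
`a` isolate gaps. -/
theorem moment_psi {a : ℕ} (ha : a ≤ N) :
    ∑ q, b q * ((psi l m a N).2.2.eval (ev q) / ev q) =
      (phi l m N).2.1.coeff 1 / (2 * M) + ∑ j ∈ Finset.Ico a N, l j := by
  have hM := h.total_mass_pos.ne'
  have hdeg : (minor l m N a).natDegree ≤ N := phi_psi_minor_natDegree_le l m ha
  have hs := h.sum_residues (g := divX (minor l m N a)) 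
    (by rw [natDegree_divX_eq_natDegree_tsub_one]; omega)
  have h0 : (minor l m N a).coeff 0 = 0 := by
    simp [minor, mul_coeff_zero, phi_coeff_zero l m N]
  have hX : minor l m N a = X * divX (minor l m N a) := by
    conv_lhs => rw [← X_mul_divX_add (minor l m N a), h0]
    simp
  have hev : ∀ q, (divX (minor l m N a)).eval (ev q) = (minor l m N a).eval (ev q) / ev q := by
    intro q
    have := (h.ev_pos q).ne'
    conv_rhs => rw [hX]
    simp
    field_simp
  have h1 : (minor l m N a).coeff 1 =
      (phi l m N).2.1.coeff 1 + 2 * M * ∑ j ∈ Finset.Ico a N, l j := by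
    rw [minor, coeff_sub, mul_coeff_one, mul_coeff_one]
    rw [(psi_coeff_zero l m ha).1, (psi_coeff_zero l m ha).2, (phi_coeff_zero l m N).2.1,
      (phi_coeff_zero l m N).2.2.1, (phi_coeff_zero l m N).2.2.2, h.mass_sum]
    ring
  rw [← coeff_zero_eq_eval_zero, coeff_divX, coeff_divX, zero_add, h1,
    -- Coefficient `N` of the quotient is coefficient `N + 1` of `minor`, so the residue sum is
    -- zero.
    coeff_eq_zero_of_natDegree_lt (Nat.lt_succ_of_le hdeg), zero_div] at hs
  have hsum : ∑ q, b q * ((psi l m a N).2.2.eval (ev q) / ev q) =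
      ∑ q, (divX (minor l m N a)).eval (ev q) / (derivative (phi l m N).2.2).eval (ev q) := by
    refine Finset.sum_congr rfl fun q _ => ?_
    rw [hev, div_right_comm, h.minor_eval_div, mul_div_assoc]
  rw [hsum, eq_neg_of_add_eq_zero_right hs]
  field_simp

end IsSpectral

end Residue
end CubicOrbit

/-! ### Biorthogonal polynomials and evaluation of the determinants. -/

namespace CubicOrbit

open Polynomial CubicMoments

variable {N : ℕ} {ev b : Fin N → ℝ} {M : ℝ} {l m : ℕ → ℝ}

/-- The orthogonal polynomial of degree `k`: the value of `ψ''(xₙ+)` for `ψ = psi (N - k)`. -/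
noncomputable def orthoPoly (l m : ℕ → ℝ) (N k : ℕ) : ℝ[X] := (psi l m (N - k) N).2.2

/-- The pairing of `orthoPoly k` with `X ^ k`. -/
noncomputable def orthoNorm (l m : ℕ → ℝ) (N k : ℕ) : ℝ :=
  1 / (2 * m (N - k) * growth l m (N - k) N)

theorem growth_succ {k : ℕ} (hk : k < N) :
    growth l m (N - (k + 1)) N =
      -(m (N - k) * l (N - (k + 1)) ^ 2) * growth l m (N - k) N := by
  rw [growth, growth, Finset.prod_eq_prod_Ico_succ_bot (by omega : N - (k + 1) < N),
    show N - (k + 1) + 1 = N - k by omega]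

/-- The factor `growth N N` is an empty product, so shifting the index only adds the last factor. -/
theorem prod_growth_succ (k : ℕ) :
    ∏ i : Fin k, growth l m (N - (i + 1)) N =
      (∏ i : Fin k, growth l m (N - i) N) * growth l m (N - k) N := by
  have h1 := Fin.prod_univ_succ fun i : Fin (k + 1) => growth l m (N - i) N
  rw [Fin.prod_univ_castSucc] at h1
  simpa [growth] using h1.symm

theorem orthoPoly_natDegree_le {k : ℕ} (hk : k ≤ N) : (orthoPoly l m N k).natDegree ≤ k :=
  (psi_natDegree_le l m (Nat.sub_le N k)).2.2.trans (by omega)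

theorem orthoPoly_coeff {k : ℕ} (hk : k ≤ N) :
    (orthoPoly l m N k).coeff k = growth l m (N - k) N := by
  have := psi_coeff_top l m (Nat.sub_le N k)
  rwa [show N - (N - k) = k by omega] at this

theorem orthoPoly_coeff_zero (k : ℕ) : (orthoPoly l m N k).coeff 0 = 1 :=
  (psi_coeff_zero l m (Nat.sub_le N k)).2

/-- `(orthoPoly (k + 1) - orthoPoly k) / X`. -/
noncomputable def orthoDiff (l m : ℕ → ℝ) (N k : ℕ) : ℝ[X] :=
  divX (orthoPoly l m N (k + 1) - orthoPoly l m N k)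

theorem X_mul_orthoDiff (k : ℕ) :
    X * orthoDiff l m N k = orthoPoly l m N (k + 1) - orthoPoly l m N k := by
  conv_rhs => rw [← X_mul_divX_add (orthoPoly l m N (k + 1) - orthoPoly l m N k)]
  simp [orthoDiff, orthoPoly_coeff_zero]

theorem orthoDiff_natDegree_le {k : ℕ} (hk : k < N) : (orthoDiff l m N k).natDegree ≤ k := by
  rw [orthoDiff, natDegree_divX_eq_natDegree_tsub_one]
  have h := (natDegree_sub_le (orthoPoly l m N (k + 1)) (orthoPoly l m N k)).trans
    (max_le (orthoPoly_natDegree_le hk) ((orthoPoly_natDegree_le hk.le).trans k.le_succ))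
  omega

theorem orthoDiff_coeff {k : ℕ} (hk : k < N) :
    (orthoDiff l m N k).coeff k = growth l m (N - (k + 1)) N := by
  rw [orthoDiff, coeff_divX, coeff_sub, orthoPoly_coeff hk,
    coeff_eq_zero_of_natDegree_lt (Nat.lt_succ_of_le (orthoPoly_natDegree_le hk.le)), sub_zero]

theorem biform_X_pow (i j : ℕ) : biform ev b j (X ^ i) = bimoment ev b i j := by
  simp [biform, bimoment]

theorem biformA_apply (j : ℕ) (f : ℝ[X]) :
    biformA ev b M j f = biform ev b j f + (if j = 0 then 1 / (2 * M) else 0) * f.coeff 0 := rfl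

theorem biformA_X_pow (i j : ℕ) :
    biformA ev b M j (X ^ i) =
      bimoment ev b i j + if i = 0 ∧ j = 0 then 1 / (2 * M) else 0 := by
  rw [biformA_apply, biform_X_pow]
  rcases Nat.eq_zero_or_pos i with rfl | hi
  · simp
  · simp [hi.ne', coeff_X_pow, hi.ne]

theorem moment_X_pow (i : ℕ) : moment ev b (X ^ i) = beta ev b i := by
  simp [moment, beta]

namespace IsSpectral

variable (h : IsSpectral l m ev b M)

include h

theorem biformA_orthoPoly_of_lt {k j : ℕ} (hk : k ≤ N) (hj : j < k) :
    biformA ev b M j (orthoPoly l m N k) = 0 := by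
  rw [orthoPoly, h.biformA_psi (Nat.sub_le N k) (by omega), coeff_eq_zero_of_natDegree_lt]
  · simp
  · refine natDegree_mul_le.trans_lt ?_
    have := (phi_natDegree_le l m (N - k)).1
    rw [natDegree_X_pow]
    omega

/-- The top coefficient of `φ_a` occurs in both numerator and denominator and cancels, leaving only
the mass and `growth`. -/
theorem biformA_orthoPoly_self {k : ℕ} (hk : k ≤ N) :
    biformA ev b M k (orthoPoly l m N k) = orthoNorm l m N k := by
  have h1 : (X ^ k * (phi l m (N - k)).1).coeff N = (phi l m (N - k)).1.coeff (N - k) := by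
    conv_lhs => rw [show N = N - k + k by omega, coeff_X_pow_mul]
    rw [show N - k + k = N by omega]
  have h2 := phi_coeff_top l m (Nat.sub_le N k)
  have h3 := h.phi_coeff_top_ne_zero
  rw [orthoPoly, h.biformA_psi (Nat.sub_le N k) (by omega), h1, orthoNorm]
  rw [h2] at h3 ⊢
  have hg := left_ne_zero_of_mul h3
  have hc := right_ne_zero_of_mul (right_ne_zero_of_mul h3)
  have hm := (h.mass_pos (N - k) (Nat.sub_le N k)).ne'
  field_simp

theorem biform_X_mul_orthoDiff {k j : ℕ} (hk : k < N) (hj : j ≤ k) :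
    biform ev b j (X * orthoDiff l m N k) = if j = k then -orthoNorm l m N k else 0 := by
  -- The factor `X` kills the constant term and with it the `1/(2M)` correction.
  have h0 : biform ev b j (X * orthoDiff l m N k) =
      biformA ev b M j (X * orthoDiff l m N k) := by simp [biformA_apply]
  rw [h0, X_mul_orthoDiff, map_sub, h.biformA_orthoPoly_of_lt hk (by omega), zero_sub]
  split_ifs with hjk
  · rw [hjk, h.biformA_orthoPoly_self hk.le]
  · rw [h.biformA_orthoPoly_of_lt hk.le (by omega), neg_zero]

theorem moment_orthoDiff {k : ℕ} (hk : k < N) :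
    moment ev b (orthoDiff l m N k) = l (N - (k + 1)) := by
  have hd : moment ev b (orthoDiff l m N k) =
      ∑ q, b q * ((orthoPoly l m N (k + 1)).eval (ev q) / ev q) -
        ∑ q, b q * ((orthoPoly l m N k).eval (ev q) / ev q) := by
    rw [← Finset.sum_sub_distrib]
    change ∑ q, b q * (orthoDiff l m N k).eval (ev q) = _
    refine Finset.sum_congr rfl fun q _ => ?_
    have hq := (h.ev_pos q).ne'
    have he := congrArg (eval (ev q)) (X_mul_orthoDiff (l := l) (m := m) (N := N) k)
    rw [eval_mul, eval_X, eval_sub] at he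
    field_simp
    linear_combination b q * he
  rw [hd, orthoPoly, orthoPoly, h.moment_psi (Nat.sub_le _ _), h.moment_psi (Nat.sub_le _ _),
    Finset.sum_eq_sum_Ico_succ_bot (by omega : N - (k + 1) < N),
    show N - (k + 1) + 1 = N - k by omega]
  ring

theorem growth_prod_mul_detA {k : ℕ} (hk : k ≤ N + 1) :
    (∏ i : Fin k, growth l m (N - i) N) * detA ev b M k = ∏ i : Fin k, orthoNorm l m N i := by
  have hp := prod_coeff_mul_det (fun j : Fin k => biformA ev b M j)
    (fun i : Fin k => orthoPoly l m N i) (fun i => orthoPoly_natDegree_le (by omega))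
  simp only [biformA_X_pow] at hp
  rw [Finset.prod_congr rfl fun (i : Fin k) _ => orthoPoly_coeff (l := l) (m := m)
    (by omega : (i : ℕ) ≤ N)] at hp
  rw [detA, hp, Matrix.det_of_isUpperTriangular]
  · exact Finset.prod_congr rfl fun i _ => h.biformA_orthoPoly_self (by omega)
  · intro i j hij
    have hij' : (j : ℕ) < i := hij
    exact h.biformA_orthoPoly_of_lt (by omega) hij'

theorem growth_prod_mul_detD {k : ℕ} (hk : k ≤ N) :
    (∏ i : Fin k, growth l m (N - (i + 1)) N) * detD ev b k =
      ∏ i : Fin k, -orthoNorm l m N i := by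
  have hp := prod_coeff_mul_det
    (fun j : Fin k => biform ev b j ∘ₗ LinearMap.mulLeft ℝ (X : ℝ[X]))
    (fun i : Fin k => orthoDiff l m N i) (fun i => orthoDiff_natDegree_le (by omega))
  simp only [LinearMap.comp_apply, LinearMap.mulLeft_apply, ← pow_succ', biform_X_pow] at hp
  rw [Finset.prod_congr rfl fun (i : Fin k) _ => orthoDiff_coeff (l := l) (m := m)
    (by omega : (i : ℕ) < N)] at hp
  rw [detD, hp, Matrix.det_of_isUpperTriangular]
  · exact Finset.prod_congr rfl fun i _ =>
      (h.biform_X_mul_orthoDiff (by omega) le_rfl).trans (if_pos rfl)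
  · intro i j hij
    have hij' : (j : ℕ) < i := hij
    exact (h.biform_X_mul_orthoDiff (by omega) hij'.le).trans (if_neg hij'.ne)

/-- In the basis `orthoDiff` the last row is zero except for its moment entry, which is the gap.
Deleting that row and the moment column leaves a triangular matrix. -/
theorem growth_prod_mul_detD' {k : ℕ} (hk : k < N) :
    (∏ i : Fin (k + 1), growth l m (N - (i + 1)) N) * detD' ev b (k + 1) =
      l (N - (k + 1)) * ∏ i : Fin k, orthoNorm l m N i := by
  have hp := prod_coeff_mul_det
    (fun j : Fin (k + 1) => if (j : ℕ) = 0 then moment ev b else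
      biform ev b (j - 1) ∘ₗ LinearMap.mulLeft ℝ (X : ℝ[X]))
    (fun i : Fin (k + 1) => orthoDiff l m N i) (fun i => orthoDiff_natDegree_le (by omega))
  have hT : ∀ (j : ℕ) (f : ℝ[X]), (if j = 0 then moment ev b else
      biform ev b (j - 1) ∘ₗ LinearMap.mulLeft ℝ (X : ℝ[X])) f =
      if j = 0 then moment ev b f else biform ev b (j - 1) (X * f) := by
    intro j f
    split_ifs <;> rfl
  simp only [hT, moment_X_pow, ← pow_succ', biform_X_pow] at hp
  rw [Finset.prod_congr rfl fun (i : Fin (k + 1)) _ => orthoDiff_coeff (l := l) (m := m)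
    (by omega : (i : ℕ) < N)] at hp
  rw [detD', hp, Matrix.det_succ_row _ (Fin.last k), Fin.sum_univ_succ,
    Finset.sum_eq_zero fun j _ => ?_, add_zero, Matrix.det_of_isUpperTriangular]
  · have hd : ∀ i : Fin k, biform ev b i (X * orthoDiff l m N i) = -orthoNorm l m N i :=
      fun i => (h.biform_X_mul_orthoDiff (by omega) le_rfl).trans (if_pos rfl)
    simp only [Fin.succAbove_last, Fin.succAbove_zero, Matrix.submatrix_apply, Matrix.of_apply,
      Fin.val_last, Fin.val_zero, if_true, h.moment_orthoDiff hk, Fin.val_succ, Fin.val_castSucc,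
      Nat.add_sub_cancel, Nat.succ_ne_zero, if_false, hd]
    rw [Finset.prod_neg, Finset.card_univ, Fintype.card_fin]
    -- The cofactor sign cancels the `k` signs of the diagonal entries.
    have hs : ((-1 : ℝ) ^ k) * (-1) ^ k = 1 := by rw [← mul_pow]; simp
    linear_combination l (N - (k + 1)) * (∏ i : Fin k, orthoNorm l m N i) * hs
  · intro i j hij
    have hij' : (j : ℕ) < i := hij
    have hd := (h.biform_X_mul_orthoDiff (by omega : (i : ℕ) < N) hij'.le).trans (if_neg hij'.ne)
    simpa using hd
  · have hd := (h.biform_X_mul_orthoDiff hk j.2.le).trans (if_neg j.2.ne)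
    simp [hd]

theorem prod_orthoNorm_ne_zero (k : ℕ) :
    ∏ i : Fin k, orthoNorm l m N i ≠ 0 :=
  Finset.prod_ne_zero_iff.2 fun _ _ => one_div_ne_zero <|
    mul_ne_zero (mul_ne_zero two_ne_zero (h.mass_pos _ (Nat.sub_le _ _)).ne')
      (h.growth_ne_zero le_rfl)

theorem prod_growth_ne_zero (k : ℕ) : ∏ i : Fin k, growth l m (N - i) N ≠ 0 :=
  Finset.prod_ne_zero_iff.2 fun _ _ => h.growth_ne_zero le_rfl

theorem mass_eq {k : ℕ} (hk : k ≤ N) :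
    m (N - k) = detD ev b k ^ 2 / (2 * detA ev b M (k + 1) * detA ev b M k) := by
  have hA := h.growth_prod_mul_detA (Nat.le_succ_of_le hk)
  have hA' := h.growth_prod_mul_detA (Nat.succ_le_succ hk)
  have hD := h.growth_prod_mul_detD hk
  have hG := h.prod_orthoNorm_ne_zero k
  have hP := h.prod_growth_ne_zero k
  have hκ := h.growth_ne_zero (a := N - k) le_rfl
  have hm := (h.mass_pos (N - k) (Nat.sub_le N k)).ne'
  rw [prod_growth_succ, Finset.prod_neg, Finset.card_univ, Fintype.card_fin] at hD
  simp only [Fin.prod_univ_castSucc, Fin.val_castSucc, Fin.val_last] at hA'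
  have hs : ((-1 : ℝ) ^ k) ^ 2 = 1 := by rw [← pow_mul, mul_comm, pow_mul]; simp
  rw [orthoNorm] at hA'
  generalize (∏ i : Fin k, orthoNorm l m N i) = G at *
  generalize (∏ i : Fin k, growth l m (N - i) N) = P at *
  generalize growth l m (N - k) N = κ at *
  rw [eq_div_of_mul_eq hP ((mul_comm _ _).trans hA),
    eq_div_of_mul_eq (mul_ne_zero hP hκ) ((mul_comm _ _).trans hA'),
    eq_div_of_mul_eq (mul_ne_zero hP hκ) ((mul_comm _ _).trans hD), div_pow, mul_pow _ G, hs]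
  field_simp

theorem gap_eq {k : ℕ} (hk : k < N) :
    l (N - (k + 1)) = -2 * detA ev b M (k + 1) / detD' ev b (k + 1) := by
  have hA := h.growth_prod_mul_detA (Nat.succ_le_succ hk.le)
  have hD := h.growth_prod_mul_detD' hk
  have hG := h.prod_orthoNorm_ne_zero k
  have hP := h.prod_growth_ne_zero (k + 1)
  have hκ := h.growth_ne_zero (a := N - k) le_rfl
  have hm := (h.mass_pos (N - k) (Nat.sub_le N k)).ne'
  have hl := (h.gap_pos (N - (k + 1)) (by omega)).ne'
  rw [prod_growth_succ, growth_succ hk] at hD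
  simp only [Fin.prod_univ_castSucc (fun i : Fin (k + 1) => orthoNorm l m N i),
    Fin.val_castSucc, Fin.val_last] at hA
  rw [orthoNorm] at hA
  generalize (∏ i : Fin k, orthoNorm l m N i) = G at *
  generalize (∏ i : Fin (k + 1), growth l m (N - i) N) = P at *
  generalize growth l m (N - k) N = κ at *
  -- The extra `growth` factor carries `l²` while `detD'` carries one `l`, so the quotient leaves
  -- the gap itself.
  have hne : P * (-(m (N - k) * l (N - (k + 1)) ^ 2) * κ) ≠ 0 := by simp [*]
  rw [eq_div_of_mul_eq hP ((mul_comm _ _).trans hA),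
    eq_div_of_mul_eq hne ((mul_comm _ _).trans hD)]
  field_simp

end IsSpectral

end CubicOrbit

/-! ### From solutions on the line to the polynomial states. -/

namespace CubicString

open Polynomial CubicOrbit CubicMoments

variable {N : ℕ} {s : CubicString N} {z : ℂ} {φ : ℝ → ℂ}

theorem eq_of_hasDerivAt_zero {F : ℝ → ℂ} (hF : Continuous F) {U : Set ℝ} (hU : IsOpen U)
    (hU' : IsPreconnected U) (hd : ∀ x ∈ U, HasDerivAt F 0 x) {a x : ℝ} (ha : a ∈ closure U)
    (hx : x ∈ closure U) : F x = F a := by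
  obtain ⟨c, hc⟩ := hU.exists_is_const_of_deriv_eq_zero hU'
    (fun x hx => (hd x hx).differentiableAt.differentiableWithinAt) (fun x hx => (hd x hx).deriv)
  have h : Set.EqOn F (fun _ => c) (closure U) := Set.EqOn.closure hc hF continuous_const
  rw [h ha, h hx]

namespace IsSolution

variable (hs : s.IsSolution z φ)

include hs

theorem contDiffOn {U : Set ℝ} (hfree : ∀ x ∈ U, x ∉ Set.range s.pos) : ContDiffOn ℝ 3 φ U :=
  fun x hx => (hs.free x (hfree x hx)).1.contDiffWithinAt

theorem exists_iteratedDeriv_two_eq {U : Set ℝ} (hU : IsOpen U) (hU' : IsPreconnected U)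
    (hfree : ∀ x ∈ U, x ∉ Set.range s.pos) : ∃ c, ∀ x ∈ U, iteratedDeriv 2 φ x = c := by
  refine hU.exists_is_const_of_deriv_eq_zero hU' ?_ fun x hx => ?_
  · have h1 : ContDiffOn ℝ 2 (deriv φ) U :=
      (hs.contDiffOn hfree).deriv_of_isOpen hU (by norm_num)
    have h2 : ContDiffOn ℝ 1 (deriv (deriv φ)) U := h1.deriv_of_isOpen hU (by norm_num)
    rw [iteratedDeriv_succ, iteratedDeriv_one]
    exact h2.differentiableOn one_ne_zero
  · rw [← iteratedDeriv_succ]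
    exact (hs.free x (hfree x hx)).2

theorem continuous_deriv : Continuous (deriv φ) := hs.contDiff.continuous_deriv le_rfl

theorem deriv_eq_and_eq {U : Set ℝ} (hU : IsOpen U) (hU' : IsPreconnected U)
    (hfree : ∀ x ∈ U, x ∉ Set.range s.pos) {c : ℂ} (hc : ∀ x ∈ U, iteratedDeriv 2 φ x = c)
    {a x : ℝ} (ha : a ∈ closure U) (hx : x ∈ closure U) :
    φ x = φ a + (x - a) * deriv φ a + (x - a) ^ 2 / 2 * c ∧
      deriv φ x = deriv φ a + (x - a) * c := by
  have hd : ∀ {x}, x ∈ closure U → deriv φ x = deriv φ a + (x - a) * c := by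
    intro x hx
    have h := eq_of_hasDerivAt_zero (F := fun y : ℝ => deriv φ y - y * c)
      (hs.continuous_deriv.sub (by fun_prop)) hU hU' (fun y hy => ?_) ha hx
    · linear_combination h
    · have h1 : ContDiffOn ℝ 2 (deriv φ) U :=
        (hs.contDiffOn hfree).deriv_of_isOpen hU (by norm_num)
      have h2 : HasDerivAt (deriv φ) c y := by
        rw [← hc y hy, iteratedDeriv_succ, iteratedDeriv_one]
        exact ((h1.differentiableOn two_ne_zero).differentiableAt (hU.mem_nhds hy)).hasDerivAt
      exact (h2.sub ((Complex.ofRealCLM.hasDerivAt (x := y)).mul_const c)).congr_deriv (by simp)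
  refine ⟨?_, hd hx⟩
  have h := eq_of_hasDerivAt_zero
    (F := fun y : ℝ => φ y - ((y - a : ℂ) * deriv φ a + (y - a) ^ 2 / 2 * c))
    (hs.contDiff.continuous.sub (by fun_prop)) hU hU' (fun y hy => ?_) ha hx
  · simp only [sub_self] at h
    linear_combination h
  · have h1 : HasDerivAt φ (deriv φ y) y :=
      (hs.contDiff.differentiable one_ne_zero y).hasDerivAt
    have h2 : HasDerivAt (fun y : ℝ => (y - a : ℂ)) 1 y := by
      simpa using (Complex.ofRealCLM.hasDerivAt (x := y)).sub_const (a : ℂ)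
    refine (h1.sub ((h2.mul_const (deriv φ a)).add
      (((h2.pow 2).div_const 2).mul_const c))).congr_deriv ?_
    rw [hd (subset_closure hy)]
    simp

end IsSolution

theorem notMem_range_of_mem_Ioo (i : Fin N) :
    ∀ x ∈ Set.Ioo (s.pos i.castSucc) (s.pos i.succ), x ∉ Set.range s.pos := by
  rintro _ hx ⟨j, rfl⟩
  have h1 := s.pos_strictMono.lt_iff_lt.1 hx.1
  have h2 := s.pos_strictMono.lt_iff_lt.1 hx.2
  rw [Fin.lt_def] at h1 h2
  simp at h1 h2
  omega

theorem notMem_range_of_mem_Iio : ∀ x ∈ Set.Iio (s.pos 0), x ∉ Set.range s.pos := by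
  rintro _ hx ⟨j, rfl⟩
  exact (s.pos_strictMono.monotone (Fin.zero_le j)).not_gt hx

theorem notMem_range_of_mem_Ioi : ∀ x ∈ Set.Ioi (s.pos (Fin.last N)), x ∉ Set.range s.pos := by
  rintro _ hx ⟨j, rfl⟩
  exact (s.pos_strictMono.monotone (Fin.le_last j)).not_gt hx

theorem pos_lt (i : Fin N) : s.pos i.castSucc < s.pos i.succ :=
  s.pos_strictMono i.castSucc_lt_succ

/-- The masses as a sequence, extended by zero. -/
noncomputable def massSeq (s : CubicString N) (i : ℕ) : ℝ :=
  if h : i < N + 1 then s.mass ⟨i, h⟩ else 0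

/-- The gaps as a sequence, extended by zero. -/
noncomputable def gapSeq (s : CubicString N) (i : ℕ) : ℝ :=
  if h : i < N then s.gap ⟨i, h⟩ else 0

theorem massSeq_val (i : Fin (N + 1)) : s.massSeq i = s.mass i := dif_pos i.2

theorem gapSeq_val (i : Fin N) : s.gapSeq i = s.gap i := dif_pos i.2

/-- The state `(φ, φ', φ'')` after each mass for the solution equal to `1` on the left. -/
noncomputable def stateSeq (s : CubicString N) (z : ℂ) : ℕ → ℂ × ℂ × ℂ :=
  orbit s.gapSeq s.massSeq z 0 (1, 0, -(2 * s.massSeq 0) • z)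

theorem stateSeq_eq_aeval (i : ℕ) :
    s.stateSeq z i = (aeval z (phi s.gapSeq s.massSeq i).1,
      aeval z (phi s.gapSeq s.massSeq i).2.1, aeval z (phi s.gapSeq s.massSeq i).2.2) := by
  have h := orbit_map (aeval z) s.gapSeq s.massSeq X 0 (1, 0, -(2 * s.massSeq 0) • (X : ℝ[X])) i
  simpa [stateSeq, phi] using h

namespace IsSolution

variable (hs : s.IsSolution z φ)

include hs

/-- The second derivative is constant on each gap, so its right limit `q` at one mass is the left
limit at the next. The last clause accepts any left limit at the first mass, to serve both
eigenfunctions and the normalised solution. -/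
theorem exists_states : ∃ q : Fin (N + 1) → ℂ,
    (∀ i, Tendsto (iteratedDeriv 2 φ) (𝓝[>] (s.pos i)) (𝓝 (q i))) ∧
    (∀ i : Fin N, ∀ x ∈ Set.Icc (s.pos i.castSucc) (s.pos i.succ),
      φ x = φ (s.pos i.castSucc) + (x - s.pos i.castSucc) * deriv φ (s.pos i.castSucc) +
        (x - s.pos i.castSucc) ^ 2 / 2 * q i.castSucc) ∧
    (∀ i : Fin N, (φ (s.pos i.succ), deriv φ (s.pos i.succ), q i.succ) =
      step (s.gapSeq i) (s.massSeq (i + 1)) z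
        (φ (s.pos i.castSucc), deriv φ (s.pos i.castSucc), q i.castSucc)) ∧
    (∀ p, Tendsto (iteratedDeriv 2 φ) (𝓝[<] (s.pos 0)) (𝓝 p) →
      q 0 = p - 2 * z * s.mass 0 * φ (s.pos 0)) := by
  choose p q hp hq hj using hs.jump
  have key : ∀ i : Fin N, ∀ x ∈ Set.Ioo (s.pos i.castSucc) (s.pos i.succ),
      iteratedDeriv 2 φ x = q i.castSucc := by
    intro i
    obtain ⟨c, hc⟩ := hs.exists_iteratedDeriv_two_eq isOpen_Ioo isPreconnected_Ioo
      (notMem_range_of_mem_Ioo i)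
    have : q i.castSucc = c := tendsto_nhds_unique (hq i.castSucc)
      (tendsto_const_nhds.congr' (by
        filter_upwards [Ioo_mem_nhdsGT (pos_lt i)] with x hx using (hc x hx).symm))
    rwa [this]
  have hcl : ∀ i : Fin N, closure (Set.Ioo (s.pos i.castSucc) (s.pos i.succ)) =
      Set.Icc (s.pos i.castSucc) (s.pos i.succ) := fun i => closure_Ioo (pos_lt i).ne
  have hquad : ∀ i : Fin N, ∀ x ∈ Set.Icc (s.pos i.castSucc) (s.pos i.succ), _ := fun i x hx =>
    hs.deriv_eq_and_eq isOpen_Ioo isPreconnected_Ioo (notMem_range_of_mem_Ioo i) (key i)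
      (a := s.pos i.castSucc) (x := x) (by rw [hcl]; exact Set.left_mem_Icc.2 (pos_lt i).le)
      (by rw [hcl]; exact hx)
  refine ⟨q, hq, fun i x hx => (hquad i x hx).1, fun i => ?_, fun p' hp' => ?_⟩
  · obtain ⟨h1, h2⟩ := hquad i _ (Set.right_mem_Icc.2 (pos_lt i).le)
    have hpq : p i.succ = q i.castSucc := tendsto_nhds_unique (hp i.succ)
      (tendsto_const_nhds.congr' (by
        filter_upwards [Ioo_mem_nhdsLT (pos_lt i)] with x hx using (key i x hx).symm))
    have hm : s.massSeq (i + 1) = s.mass i.succ := massSeq_val i.succ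
    have hj' := hj i.succ
    rw [hpq, h1] at hj'
    rw [h1, h2, hm, gapSeq_val]
    simp only [step, gap, Complex.real_smul, Prod.mk.injEq]
    push_cast
    refine ⟨by ring, by ring, by linear_combination hj'⟩
  · rw [tendsto_nhds_unique hp' (hp 0)]
    linear_combination hj 0

end IsSolution

theorem states_eq {q : Fin (N + 1) → ℂ}
    (hq : ∀ i : Fin N, (φ (s.pos i.succ), deriv φ (s.pos i.succ), q i.succ) =
      step (s.gapSeq i) (s.massSeq (i + 1)) z
        (φ (s.pos i.castSucc), deriv φ (s.pos i.castSucc), q i.castSucc))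
    (h1 : deriv φ (s.pos 0) = 0) (h2 : q 0 = -2 * z * s.mass 0 * φ (s.pos 0)) (i : Fin (N + 1)) :
    (φ (s.pos i), deriv φ (s.pos i), q i) = φ (s.pos 0) • s.stateSeq z i := by
  induction i using Fin.induction with
  | zero =>
    have hm : s.massSeq 0 = s.mass 0 := massSeq_val 0
    simp only [h1, h2, stateSeq, Fin.val_zero, orbit, hm]
    ext <;> simp
    ring
  | succ i ih =>
    rw [hq, ih, stateSeq, Fin.val_succ, orbit_succ _ _ _ (Nat.zero_le _), Fin.val_castSucc]
    ext <;> simp [step] <;> ring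

theorem IsEigenvalue.aeval_eq_zero (h : s.IsEigenvalue z) :
    aeval z (phi s.gapSeq s.massSeq N).2.2 = 0 := by
  obtain ⟨φ, hne, hs, hb1, hb2, ht⟩ := h
  obtain ⟨q, hq, hquad, hstep, hjump⟩ := hs.exists_states
  obtain ⟨c, hc⟩ := hs.exists_iteratedDeriv_two_eq isOpen_Iio isPreconnected_Iio
    notMem_range_of_mem_Iio
  obtain ⟨d, hd⟩ := hs.exists_iteratedDeriv_two_eq isOpen_Ioi isPreconnected_Ioi
    notMem_range_of_mem_Ioi
  -- On each outer half-line `φ''` is constant, hence equal to its limit at infinity.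
  have hc0 : c = 0 := tendsto_nhds_unique (tendsto_const_nhds.congr' (by
    filter_upwards [eventually_lt_atBot (s.pos 0)] with x hx using (hc x hx).symm)) hb2
  have hd0 : d = 0 := tendsto_nhds_unique (tendsto_const_nhds.congr' (by
    filter_upwards [eventually_gt_atTop (s.pos (Fin.last N))] with x hx using (hd x hx).symm)) ht
  subst hc0 hd0
  have hleft : ∀ x ≤ s.pos 0, _ := fun x hx =>
    hs.deriv_eq_and_eq isOpen_Iio isPreconnected_Iio notMem_range_of_mem_Iio hc
      (a := s.pos 0) (x := x) (by simp) (by simpa using hx)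
  have hd1 : deriv φ (s.pos 0) = 0 := tendsto_nhds_unique (tendsto_const_nhds.congr' (by
    filter_upwards [eventually_le_atBot (s.pos 0)] with x hx
    simpa using (hleft x hx).2.symm)) hb1
  have hq0 := hjump 0 (tendsto_const_nhds.congr' (by
    filter_upwards [self_mem_nhdsWithin] with x hx using (hc x hx).symm))
  have hqN : q (Fin.last N) = 0 := tendsto_nhds_unique (hq _) (tendsto_const_nhds.congr' (by
    filter_upwards [self_mem_nhdsWithin] with x hx using (hd x hx).symm))
  have hst := states_eq hstep hd1 (by rw [hq0]; ring)
  have hlast := hst (Fin.last N)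
  rw [stateSeq_eq_aeval, hqN] at hlast
  have h3 := congrArg (fun u => u.2.2) hlast
  simp only [Fin.val_last, Prod.smul_snd, smul_eq_mul] at h3
  -- Every state is a multiple of `φ` at the first mass, so its vanishing there would make `φ`
  -- identically zero.
  refine (mul_eq_zero.1 h3.symm).resolve_left fun h0 => hne ?_
  have hzero : ∀ i, φ (s.pos i) = 0 ∧ deriv φ (s.pos i) = 0 ∧ q i = 0 := by
    intro i
    have := hst i
    rw [h0, zero_smul] at this
    simpa using this
  have hle : ∀ i, ∀ x ≤ s.pos i, φ x = 0 := by
    intro i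
    induction i using Fin.induction with
    | zero =>
      intro x hx
      simpa [h0, hd1] using (hleft x hx).1
    | succ i ih =>
      intro x hx
      rcases le_total x (s.pos i.castSucc) with hx' | hx'
      · exact ih x hx'
      · simpa [hzero i.castSucc] using hquad i x ⟨hx', hx⟩
  funext x
  rcases le_total x (s.pos (Fin.last N)) with hx | hx
  · exact hle _ x hx
  · simpa [hzero (Fin.last N)] using (hs.deriv_eq_and_eq isOpen_Ioi isPreconnected_Ioi
      notMem_range_of_mem_Ioi hd (a := s.pos (Fin.last N)) (x := x) (by simp) (by simpa using hx)).1

theorem IsWeylValue.eq_div {w : ℂ} (h : s.IsWeylValue z w) :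
    aeval z (phi s.gapSeq s.massSeq N).2.2 ≠ 0 ∧
      w = aeval z (phi s.gapSeq s.massSeq N).2.1 / aeval z (phi s.gapSeq s.massSeq N).2.2 := by
  obtain ⟨φ, hs, hone, a, ha, hta, rfl⟩ := h
  obtain ⟨q, hq, -, hstep, hjump⟩ := hs.exists_states
  have hloc : ∀ x < s.pos 0, φ =ᶠ[𝓝 x] fun _ => 1 := fun x hx => by
    filter_upwards [Iio_mem_nhds hx] with y hy using hone y hy
  have hmem : s.pos 0 ∈ closure (Set.Iio (s.pos 0)) := by simp
  have h0 : φ (s.pos 0) = 1 := Set.EqOn.closure (s := Set.Iio (s.pos 0)) (g := fun _ => (1 : ℂ))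
    hone hs.contDiff.continuous continuous_const hmem
  have h1 : deriv φ (s.pos 0) = 0 := Set.EqOn.closure (s := Set.Iio (s.pos 0))
    (g := fun _ => (0 : ℂ)) (fun x hx => by rw [(hloc x hx).deriv_eq, deriv_const])
    hs.continuous_deriv continuous_const hmem
  have hq0 := hjump 0 (tendsto_const_nhds.congr' (by
    filter_upwards [self_mem_nhdsWithin] with x hx
    rw [(hloc x hx).iteratedDeriv_eq]
    simp [iteratedDeriv_const]))
  have hst := states_eq hstep h1 (by rw [hq0]; ring) (Fin.last N)
  rw [h0, one_smul, stateSeq_eq_aeval, Fin.val_last, Prod.mk.injEq, Prod.mk.injEq] at hst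
  rw [tendsto_nhds_unique hta (hq _)] at ha ⊢
  rw [← hst.2.1, ← hst.2.2]
  exact ⟨ha, rfl⟩

theorem aeval_ofReal_eq (p : ℝ[X]) (x : ℝ) : aeval (x : ℂ) p = ((p.eval x : ℝ) : ℂ) :=
  aeval_algebraMap_apply_eq_algebraMap_eval x p

theorem IsSpectralData.isSpectral {ev b : Fin N → ℝ} {M : ℝ} (h : s.IsSpectralData ev b M) :
    IsSpectral s.gapSeq s.massSeq ev b M where
  mass_pos i hi := by
    rw [massSeq, dif_pos (Nat.lt_succ_of_le hi)]
    exact s.mass_pos _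
  gap_pos i hi := by
    rw [gapSeq, dif_pos hi]
    exact sub_pos.2 (pos_lt _)
  ev_pos := h.ev_pos
  ev_inj := h.ev_strictMono.injective
  eval_eq_zero q := by
    have h0 : (ev q : ℂ) ≠ 0 := Complex.ofReal_ne_zero.2 (h.ev_pos q).ne'
    have := ((h.isEigenvalue_iff _ h0).2 ⟨q, rfl⟩).aeval_eq_zero
    rwa [aeval_ofReal_eq, Complex.ofReal_eq_zero] at this
  weyl x hx0 hx := by
    have hne : ¬ s.IsEigenvalue x := by
      rw [h.isEigenvalue_iff _ (Complex.ofReal_ne_zero.2 hx0)]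
      rintro ⟨q, hq⟩
      exact hx q (Complex.ofReal_injective hq)
    obtain ⟨h1, h2⟩ := (h.weyl _ hne).eq_div
    rw [eq_div_iff h1, aeval_ofReal_eq, aeval_ofReal_eq] at h2
    rw [mul_comm]
    exact_mod_cast h2.symm
  mass_sum := by
    rw [h.mass_sum, Finset.sum_range]
    exact Finset.sum_congr rfl fun i _ => (massSeq_val i).symm

/-! ### Translation invariance of the spectral data. -/

section Translation

variable {s' : CubicString N} {c : ℝ}

theorem IsSolution.translate (hm : s'.mass = s.mass) (hp : ∀ i, s'.pos i = s.pos i + c)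
    (hs : s.IsSolution z φ) : s'.IsSolution z fun x => φ (x - c) where
  contDiff := hs.contDiff.comp (by fun_prop)
  free x hx := by
    have hx' : x - c ∉ Set.range s.pos := by
      rintro ⟨i, hi⟩
      exact hx ⟨i, by rw [hp, hi, sub_add_cancel]⟩
    obtain ⟨h1, h2⟩ := hs.free _ hx'
    refine ⟨h1.comp x (by fun_prop), ?_⟩
    rw [iteratedDeriv_comp_sub_const]
    exact h2
  jump i := by
    obtain ⟨p, q, h1, h2, h3⟩ := hs.jump i
    have hi : s'.pos i - c = s.pos i := by rw [hp, add_sub_cancel_right]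
    have ht : Tendsto (fun x => x - c) (𝓝 (s'.pos i)) (𝓝 (s.pos i)) := by
      rw [← hi]
      exact tendsto_id.sub_const c
    rw [iteratedDeriv_comp_sub_const, hm, hi]
    refine ⟨p, q, h1.comp ?_, h2.comp ?_, h3⟩
    · refine tendsto_nhdsWithin_iff.2 ⟨ht.mono_left nhdsWithin_le_nhds, ?_⟩
      filter_upwards [self_mem_nhdsWithin] with x hx
      rw [← hi]
      exact sub_lt_sub_right hx c
    · refine tendsto_nhdsWithin_iff.2 ⟨ht.mono_left nhdsWithin_le_nhds, ?_⟩
      filter_upwards [self_mem_nhdsWithin] with x hx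
      rw [← hi]
      exact sub_lt_sub_right hx c

theorem IsEigenvalue.translate (hm : s'.mass = s.mass) (hp : ∀ i, s'.pos i = s.pos i + c)
    (h : s.IsEigenvalue z) : s'.IsEigenvalue z := by
  obtain ⟨φ, hne, hs, h1, h2, h3⟩ := h
  have hbot : Tendsto (fun x : ℝ => x - c) atBot atBot := 
    tendsto_atBot_add_const_right _ (-c) tendsto_id
  have htop : Tendsto (fun x : ℝ => x - c) atTop atTop := 
    tendsto_atTop_add_const_right _ (-c) tendsto_id
  refine ⟨fun x => φ (x - c), fun h0 => hne ?_, hs.translate hm hp, ?_, ?_, ?_⟩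
  · funext x
    simpa using congrFun h0 (x + c)
  · rw [← iteratedDeriv_one, iteratedDeriv_comp_sub_const, iteratedDeriv_one]
    exact h1.comp hbot
  · rw [iteratedDeriv_comp_sub_const]
    exact h2.comp hbot
  · rw [iteratedDeriv_comp_sub_const]
    exact h3.comp htop

theorem IsWeylValue.translate {w : ℂ} (hm : s'.mass = s.mass)
    (hp : ∀ i, s'.pos i = s.pos i + c) (h : s.IsWeylValue z w) : s'.IsWeylValue z w := by
  obtain ⟨φ, hs, h1, a, ha, hta, hw⟩ := h
  have hi : s'.pos (Fin.last N) - c = s.pos (Fin.last N) := by rw [hp, add_sub_cancel_right]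
  refine ⟨fun x => φ (x - c), hs.translate hm hp, fun x hx => h1 _ ?_, a, ha, ?_, ?_⟩
  · rw [hp] at hx
    linarith
  · rw [iteratedDeriv_comp_sub_const]
    refine hta.comp (tendsto_nhdsWithin_iff.2 ⟨?_, ?_⟩)
    · rw [← hi]
      exact (tendsto_id.sub_const c).mono_left nhdsWithin_le_nhds
    · filter_upwards [self_mem_nhdsWithin] with x hx
      rw [← hi]
      exact sub_lt_sub_right hx c
  · rw [deriv_comp_sub_const, hi, hw]

theorem IsSpectralData.translate {ev b : Fin N → ℝ} {M : ℝ} (hm : s'.mass = s.mass)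
    (hp : ∀ i, s'.pos i = s.pos i + c) (h : s.IsSpectralData ev b M) :
    s'.IsSpectralData ev b M := by
  have hp' : ∀ i, s.pos i = s'.pos i + -c := fun i => by rw [hp]; ring
  have hiff : ∀ z, s'.IsEigenvalue z ↔ s.IsEigenvalue z := fun z =>
    ⟨fun h => h.translate hm.symm hp', fun h => h.translate hm hp⟩
  exact ⟨h.ev_pos, h.ev_strictMono, fun z hz => (hiff z).trans (h.isEigenvalue_iff z hz),
    fun z hz => (h.weyl z ((hiff z).not.1 hz)).translate hm hp, by rw [hm, h.mass_sum]⟩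

end Translation

theorem IsSpectralData.mass_rev {ev b : Fin N → ℝ} {M : ℝ} (h : s.IsSpectralData ev b M)
    (k : Fin (N + 1)) :
    s.mass k.rev = detD ev b k ^ 2 / (2 * detA ev b M (k + 1) * detA ev b M k) := by
  rw [← h.isSpectral.mass_eq (Nat.le_of_lt_succ k.2), ← massSeq_val, Fin.val_rev,
    Nat.add_sub_add_right]

theorem IsSpectralData.gap_rev {ev b : Fin N → ℝ} {M : ℝ} (h : s.IsSpectralData ev b M)
    (k : Fin N) : s.gap k.rev = -2 * detA ev b M (k + 1) / detD' ev b (k + 1) := by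
  rw [← h.isSpectral.gap_eq k.2, ← gapSeq_val, Fin.val_rev]

end CubicString

open CubicMoments in
theorem mainTheorem1 {N : ℕ} (s : CubicString N) (ev b : Fin N → ℝ) (M : ℝ)
    (h : s.IsSpectralData ev b M) :
    -- `m_{n-k} = 𝒟_k² / (2 𝒜_{k+1} 𝒜_k)` for `0 ≤ k ≤ n - 1`, where `n = N + 1`
    (∀ k : Fin (N + 1),
      s.mass k.rev = detD ev b k ^ 2 / (2 * detA ev b M (k + 1) * detA ev b M k)) ∧
    -- `l_{n-k} = -2 𝒜_k / 𝒟'_k` for `1 ≤ k ≤ n - 1` (here `k` is shifted by one)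
    (∀ k : Fin N, s.gap k.rev = -2 * detA ev b M (k + 1) / detD' ev b (k + 1)) ∧
    -- the strings with these spectral data are exactly the translates of `s`
    (∀ s' : CubicString N, s'.IsSpectralData ev b M ↔
      ∃ c : ℝ, s'.mass = s.mass ∧ ∀ i, s'.pos i = s.pos i + c) := by
  refine ⟨h.mass_rev, h.gap_rev, fun s' => ⟨fun h' => ?_, fun ⟨c, hm, hp⟩ => h.translate hm hp⟩⟩
  -- The first masses fix the shift; equal gaps propagate it to all positions.
  refine ⟨s'.pos 0 - s.pos 0, funext fun i => ?_, fun i => ?_⟩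
  · rw [← Fin.rev_rev i, h.mass_rev, h'.mass_rev]
  · induction i using Fin.induction with
    | zero => ring
    | succ i ih =>
      have hg : s'.gap i = s.gap i := by rw [← Fin.rev_rev i, h.gap_rev, h'.gap_rev]
      simp only [CubicString.gap] at hg
      linarith
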